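/- Let $\mathscr B$ be a basis in $\mathbb R^n$, i.e. a collection of open sets of finite Lebesgue measure. A *Young function* is a continuous, convex, increasing function $\Phi:[0,\infty)\to[0,\infty)$ (strict monotonicity is not required) with $\Phi(0)=0$ and $\Phi(t)\to\infty$ as $t\to\infty$; $\Phi^{-1}$ denotes its inverse on $(0,\infty)$. For measurable $f$ and $B\in\mathscr B$ non-empty put $$\|f\|_{\Phi,B}=\inf\Big\{\lambda>0:\ \frac1{|B|}\int_B\Phi\Big(\frac{|f(x)|}{\lambda}\Big)dx\le 1\Big\}\in[0,\infty].$$ Let $\varphi:(0,\infty)\to(0,\infty)$ be essentially non-decreasing (for some $\rho>0$, $\varphi(s)\le\rho\,\varphi(t)$ whenever $0<s\le t$) with $\lim_{t\to\infty}\varphi(t)/t=0$. For Young functions $\vec\Psi=(\Psi_1,\dots,\Psi_m)$ and $\vec f=(f_1,\dots,f_m)$ let $$\mathcal M_{\mathscr B,\varphi,\vec\Psi}(\vec f)(x)=\sup_{x\in B\in\mathscr B}\varphi(|B|)\prod_{i=1}^m\|f_i\|_{\Psi_i,B},$$ and write $\mathcal M_{\mathscr B,\vec\Psi}$ for the operator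 with $\varphi\equiv1$. Let $M_{\mathscr B}f(x)=\sup_{x\in B\in\mathscr B}\frac1{|B|}\int_B|f|$. A supremum over the empty set is $0$, and $0\cdot\infty=0$ throughout. **Theorem.** Let $0<p\le q<\infty$ and $\frac1p=\frac1{p_1}+\cdots+\frac1{p_m}$ with $1<p_1,\dots,p_m<\infty$. Let $\mathcal A_i,\mathcal B_i,\mathcal C_i$ ($i=1,\dots,m$) be Young functions such that $\mathcal A_i^{-1}(t)\,\mathcal C_i^{-1}(t)\le\mathcal B_i^{-1}(t)$ for all $t>0$ and all $i$, and assume that $\mathcal M_{\mathscr B,\vec{\mathcal C}}$ is bounded from $L^{p_1}(\mathbb R^n)\times\cdots\times L^{p_m}(\mathbb R^n)$ to $L^p(\mathbb R^n)$. Let $w_1,\dots,w_m,v$ be weights (non-negative measurable functions on $\mathbb R^n$) such that (i) (Tauberian condition (A) for $v^q$) for some $\gamma\in(0,1)$ there is a finite constant $K$ such that, for every measurable set $E\subset\mathbb R^n$, $$\int_{\{M_{\mathscr B}(\mathbf 1_E)>\gamma\}}v^q\,dx\le K\int_E v^q\,dx;$$ (ii) $$\sup_{B\in\mathscr B,\,B\ne\emptyset}\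 \varphi(|B|)\,|B|^{\frac1q-\frac1p}\Big(\frac1{|B|}\int_Bv^q\,dx\Big)^{1/q}\prod_{i=1}^m\|w_i^{-1}\|_{\mathcal A_i,B}<\infty,$$ where $w_i^{-1}=\infty$ at zeros of $w_i$ and $\Phi(\infty)=\infty$ for Young functions $\Phi$. Then $\mathcal M_{\mathscr B,\varphi,\vec{\mathcal B}}$ is bounded from $L^{p_1}(w_1^{p_1})\times\cdots\times L^{p_m}(w_m^{p_m})$ to $L^q(v^q)$: there is a finite constant $K'$ such that, for all measurable functions $f_i\in L^{p_i}(w_i^{p_i})$, $$\Big(\int_{\mathbb R^n}\mathcal M_{\mathscr B,\varphi,\vec{\mathcal B}}(\vec f)^q\,v^q\,dx\Big)^{1/q}\le K'\prod_{i=1}^m\Big(\int_{\mathbb R^n}|f_i|^{p_i}w_i^{p_i}\,dx\Big)^{1/p_i}.$$ -/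

import Mathlib

open MeasureTheory Filter Topology
open scoped ENNReal NNReal

noncomputable section

/-- A basis in `ℝⁿ`: a collection of open sets, each of finite Lebesgue measure
(so that averages over its members and `φ (|B|)` make sense). -/
structure IsMaximalBasis {n : ℕ} (𝓑 : Set (Set (EuclideanSpace ℝ (Fin n)))) : Prop where
  isOpen : ∀ B ∈ 𝓑, IsOpen B
  volume_lt_top : ∀ B ∈ 𝓑, volume B < ∞

/-- Young functions: continuous, convex, increasing `Φ : [0,∞) → [0,∞)` with `Φ 0 = 0` and
`Φ t → ∞` as `t → ∞`. Strict monotonicity is not required. -/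
structure IsYoungFunction (Φ : ℝ≥0 → ℝ≥0) : Prop where
  continuous : Continuous Φ
  convexOn : ConvexOn ℝ≥0 Set.univ Φ
  monotone : Monotone Φ
  map_zero : Φ 0 = 0
  tendsto_atTop : Tendsto Φ atTop atTop

/-- The inverse of a Young function. For `t > 0` this is the unique `s` with `Φ s = t`. -/
def youngInv (Φ : ℝ≥0 → ℝ≥0) (t : ℝ≥0) : ℝ≥0 :=
  sInf {s : ℝ≥0 | t < Φ s}

/-- `Φ` extended to `[0,∞]` by `Φ ∞ = ∞`. -/
def youngExt (Φ : ℝ≥0 → ℝ≥0) (t : ℝ≥0∞) : ℝ≥0∞ :=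
  if t = ∞ then ∞ else (Φ t.toNNReal : ℝ≥0∞)

/-- The `Φ`-norm (Luxemburg norm with respect to the normalized Lebesgue measure on `B`) of a
`[0,∞]`-valued function `g`: the infimum of all real `c > 0` with
`|B|⁻¹ ∫_B Φ (g / c) ≤ 1`; it is `∞` if there is no such `c`. -/
def orliczNorm {n : ℕ} (Φ : ℝ≥0 → ℝ≥0) (B : Set (EuclideanSpace ℝ (Fin n)))
    (g : EuclideanSpace ℝ (Fin n) → ℝ≥0∞) : ℝ≥0∞ :=
  ⨅ (c : ℝ≥0) (_ : 0 < c ∧ ⨍⁻ x in B, youngExt Φ (g x / c) ∂volume ≤ 1), (c : ℝ≥0∞)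

/-- The multilinear Orlicz maximal operator associated with `φ`:
`sup_{x ∈ B ∈ 𝓑} φ(|B|) ∏ᵢ ‖fᵢ‖_{Ψᵢ,B}`. -/
def orliczMaximal {n m : ℕ} (𝓑 : Set (Set (EuclideanSpace ℝ (Fin n)))) (φ : ℝ → ℝ)
    (Ψ : Fin m → ℝ≥0 → ℝ≥0) (f : Fin m → EuclideanSpace ℝ (Fin n) → ℂ)
    (x : EuclideanSpace ℝ (Fin n)) : ℝ≥0∞ :=
  ⨆ (B : Set (EuclideanSpace ℝ (Fin n))) (_ : B ∈ 𝓑 ∧ x ∈ B),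
    ENNReal.ofReal (φ (volume.real B)) * ∏ i, orliczNorm (Ψ i) B (fun y => ‖f i y‖ₑ)

/-- The (linear) maximal operator of the basis, applied to a `[0,∞]`-valued function. -/
def basisMaximal {n : ℕ} (𝓑 : Set (Set (EuclideanSpace ℝ (Fin n))))
    (g : EuclideanSpace ℝ (Fin n) → ℝ≥0∞) (x : EuclideanSpace ℝ (Fin n)) : ℝ≥0∞ :=
  ⨆ (B : Set (EuclideanSpace ℝ (Fin n))) (_ : B ∈ 𝓑 ∧ x ∈ B), ⨍⁻ y in B, g y ∂volume

/-- The measure `w(x)^r dx`. -/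
def powerWeightMeasure {n : ℕ} (w : EuclideanSpace ℝ (Fin n) → ℝ≥0) (r : ℝ) :
    Measure (EuclideanSpace ℝ (Fin n)) :=
  volume.withDensity (fun x => ((w x : ℝ≥0∞)) ^ r)

/-- The Tauberian condition (A) of the basis with respect to `γ` and a measure `μ`. -/
def TauberianCondition {n : ℕ} (𝓑 : Set (Set (EuclideanSpace ℝ (Fin n)))) (γ : ℝ)
    (μ : Measure (EuclideanSpace ℝ (Fin n))) : Prop :=
  ∃ K : ℝ≥0, ∀ E : Set (EuclideanSpace ℝ (Fin n)), MeasurableSet E →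
    μ {x | ENNReal.ofReal γ < basisMaximal 𝓑 (E.indicator 1) x} ≤ K * μ E

/-- `φ : (0,∞) → (0,∞)` is essentially non-decreasing. -/
def EssentiallyNondecreasing (φ : ℝ → ℝ) : Prop :=
  ∃ ρ : ℝ, 0 < ρ ∧ ∀ s t : ℝ, 0 < s → s ≤ t → φ s ≤ ρ * φ t

/-- `T : L^{p₁}(μ₁) × ⋯ × L^{p_m}(μ_m) → L^q(ν)` is bounded, for an operator `T` with values in
`[0,∞]`-valued functions: `‖T f‖_{L^q(ν)} ≤ K ∏ᵢ ‖fᵢ‖_{L^{pᵢ}(μᵢ)}` for all Lebesgue measurable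
`fᵢ ∈ L^{pᵢ}(μᵢ)`, with one finite constant `K`. -/
def BoundedOperator {n m : ℕ}
    (T : (Fin m → EuclideanSpace ℝ (Fin n) → ℂ) → EuclideanSpace ℝ (Fin n) → ℝ≥0∞)
    (p : Fin m → ℝ) (μ : Fin m → Measure (EuclideanSpace ℝ (Fin n)))
    (q : ℝ) (ν : Measure (EuclideanSpace ℝ (Fin n))) : Prop :=
  ∃ K : ℝ≥0, ∀ f : Fin m → EuclideanSpace ℝ (Fin n) → ℂ,
    (∀ i, AEStronglyMeasurable (f i) volume) →
    (∀ i, MemLp (f i) (ENNReal.ofReal (p i)) (μ i)) →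
    eLpNorm (T f) (ENNReal.ofReal q) ν ≤ K * ∏ i, eLpNorm (f i) (ENNReal.ofReal (p i)) (μ i)

end

/-! The theorem splits into an estimate on a single set and a covering argument. On one `Q` of the
basis, Hölder's inequality for Luxemburg norms, applied to `f i = (w i)⁻¹ * (f i * w i)`, and the
bump condition bound `φ(|Q|) ∏ ‖f i‖_{B i,Q} (∫_Q v^q)^{1/q}` by a constant times `|Q|^{1/p} ∏ ‖f i
* w i‖_{C i,Q}` (`mul_prod_orliczNorm_mul_le_of_bump`).

To sum over sets, a finite family is run through by decreasing coefficient, and a set is kept when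
the sets already kept fill at most a fraction `γ` of it (`exists_sparse_subfamily`). Kept sets have
disjoint parts of proportional measure. At every level, the Tauberian condition absorbs the rejected
sets into the kept ones (`lintegral_sup_indicator_le_sum`). Since `q / p ≥ 1`, the sum over kept
sets is at most a power of the sum of `|Q| ∏ ‖f i * w i‖_{C i,Q}^p`. Disjointness bounds the latter
by the integral of the `p`-th power of the maximal function for `C`, whose boundedness is assumed.
Lindelöf's theorem passes from finite families to the full supremum. -/

/-! ### Young functions and the pointwise Young inequality. -/

namespace IsYoungFunction

variable {Φ Ψ Θ : ℝ≥0 → ℝ≥0}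

theorem exists_lt (h : IsYoungFunction Φ) (t : ℝ≥0) : ∃ s, t < Φ s :=
  (h.tendsto_atTop.eventually_gt_atTop t).exists

theorem le_youngInv (h : IsYoungFunction Φ) {s t : ℝ≥0} (hst : Φ s ≤ t) : s ≤ youngInv Φ t :=
  le_csInf (h.exists_lt t) fun _ hu => (h.monotone.reflect_lt (hst.trans_lt hu)).le

/-- By continuity, a value above `t` at the infimum would persist slightly to its left. With
`le_youngInv`, `youngInv Φ t` is the largest `s` with `Φ s ≤ t`, even where `Φ` is flat. -/
theorem apply_youngInv_le (h : IsYoungFunction Φ) (t : ℝ≥0) : Φ (youngInv Φ t) ≤ t := by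
  by_contra! hlt
  have hpos : 0 < youngInv Φ t := by
    rw [pos_iff_ne_zero]
    intro h0
    rw [h0, h.map_zero] at hlt
    exact not_lt_bot hlt
  have hev : ∀ᶠ s in 𝓝[<] youngInv Φ t, t < Φ s :=
    (h.continuous.continuousAt.eventually_const_lt hlt).filter_mono nhdsWithin_le_nhds
  have : (𝓝[<] youngInv Φ t).NeBot := nhdsLT_neBot_of_exists_lt ⟨0, hpos⟩
  obtain ⟨s, hs, hs'⟩ := (hev.and self_mem_nhdsWithin).exists
  have hle : youngInv Φ t ≤ s := csInf_le (OrderBot.bddBelow {s | t < Φ s}) hs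
  exact absurd hle (not_le.mpr hs')

/-- The pointwise Young inequality for three Young functions with related inverses. -/
theorem apply_mul_le (hΦ : IsYoungFunction Φ) (hΨ : IsYoungFunction Ψ) (hΘ : IsYoungFunction Θ)
    (h : ∀ t : ℝ≥0, 0 < t → youngInv Φ t * youngInv Ψ t ≤ youngInv Θ t) (x y : ℝ≥0) :
    Θ (x * y) ≤ Φ x + Ψ y := by
  -- The hypothesis on the inverses needs a positive argument, while `Φ x + Ψ y` may vanish.
  refine le_of_forall_pos_le_add fun ε hε => ?_
  refine le_trans (hΘ.monotone ?_) (hΘ.apply_youngInv_le (Φ x + Ψ y + ε))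
  refine le_trans (mul_le_mul' (hΦ.le_youngInv ?_) (hΨ.le_youngInv ?_)) (h _ (by positivity))
  · rw [add_assoc]; exact le_self_add
  · rw [add_comm (Φ x), add_assoc]; exact le_self_add

/-- Convexity between `0` and `x`. The gain compensates the two summands in Young's inequality and
is the source of the factor `2` in Hölder's. -/
theorem apply_half_mul_le (h : IsYoungFunction Φ) (x : ℝ≥0) : Φ (2⁻¹ * x) ≤ 2⁻¹ * Φ x := by
  have h2 : (2⁻¹ : ℝ≥0) + 2⁻¹ = 1 := by
    rw [← NNReal.coe_inj]; push_cast; norm_num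
  have := h.convexOn.2 (Set.mem_univ x) (Set.mem_univ 0) (zero_le (a := (2⁻¹ : ℝ≥0))) zero_le h2
  simpa [h.map_zero] using this

theorem monotone_youngExt (h : IsYoungFunction Φ) : Monotone (youngExt Φ) := by
  intro a b hab
  unfold youngExt
  split_ifs with ha hb hb
  · exact le_rfl
  · exact absurd (top_le_iff.mp (ha ▸ hab)) hb
  · exact le_top
  · exact ENNReal.coe_le_coe.mpr (h.monotone (ENNReal.toNNReal_mono hb hab))

theorem measurable_youngExt (h : IsYoungFunction Φ) : Measurable (youngExt Φ) :=
  h.monotone_youngExt.measurable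

@[simp] theorem _root_.youngExt_top : youngExt Φ ∞ = ∞ := if_pos rfl

@[simp] theorem _root_.youngExt_coe (x : ℝ≥0) : youngExt Φ x = Φ x := by
  simp [youngExt]

/-- Pointwise Young inequality on `[0,∞]`. -/
theorem youngExt_half_mul_le (hΦ : IsYoungFunction Φ) (hΨ : IsYoungFunction Ψ)
    (hΘ : IsYoungFunction Θ)
    (h : ∀ t : ℝ≥0, 0 < t → youngInv Φ t * youngInv Ψ t ≤ youngInv Θ t) (x y : ℝ≥0∞) :
    youngExt Θ (2⁻¹ * (x * y)) ≤ 2⁻¹ * (youngExt Φ x + youngExt Ψ y) := by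
  induction x with
  | top => simp
  | coe x =>
    induction y with
    | top => simp
    | coe y =>
      have := (hΘ.apply_half_mul_le (x * y)).trans
        (mul_le_mul_right (hΦ.apply_mul_le hΨ hΘ h x y) 2⁻¹)
      have h2 : (2⁻¹ : ℝ≥0∞) = ((2⁻¹ : ℝ≥0) : ℝ≥0∞) := by simp
      rw [h2, ← ENNReal.coe_mul, ← ENNReal.coe_mul, youngExt_coe, youngExt_coe, youngExt_coe]
      exact_mod_cast this

end IsYoungFunction

/-! ### Luxemburg norms. -/

section Orlicz

variable {n : ℕ} {Φ Ψ Θ : ℝ≥0 → ℝ≥0} {Q : Set (EuclideanSpace ℝ (Fin n))}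
  {f g h : EuclideanSpace ℝ (Fin n) → ℝ≥0∞}

theorem orliczNorm_le {c : ℝ≥0} (hc : 0 < c) (h : ⨍⁻ x in Q, youngExt Φ (g x / c) ∂volume ≤ 1) :
    orliczNorm Φ Q g ≤ c :=
  iInf₂_le c ⟨hc, h⟩

theorem setLAverage_youngExt_le_of_lt (hΦ : IsYoungFunction Φ) {c : ℝ≥0}
    (h : orliczNorm Φ Q g < c) : ⨍⁻ x in Q, youngExt Φ (g x / c) ∂volume ≤ 1 := by
  obtain ⟨d, hd⟩ := iInf_lt_iff.mp h
  obtain ⟨⟨hd0, hd1⟩, hdc⟩ := iInf_lt_iff.mp hd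
  refine le_trans (lintegral_mono fun x => hΦ.monotone_youngExt ?_) hd1
  exact ENNReal.div_le_div_left hdc.le _

/-- Generalized Hölder inequality for Luxemburg norms. -/
theorem orliczNorm_le_two_mul (hΦ : IsYoungFunction Φ) (hΨ : IsYoungFunction Ψ)
    (hΘ : IsYoungFunction Θ)
    (hinv : ∀ t : ℝ≥0, 0 < t → youngInv Φ t * youngInv Ψ t ≤ youngInv Θ t)
    (hg : Measurable g) (hfgh : ∀ x, g x ≠ ∞ → f x ≤ g x * h x)
    (h0 : orliczNorm Φ Q g ≠ 0) (h1 : orliczNorm Φ Q g ≠ ∞) :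
    orliczNorm Θ Q f ≤ 2 * (orliczNorm Φ Q g * orliczNorm Ψ Q h) := by
  have h2 : (2 : ℝ≥0∞)⁻¹ * orliczNorm Θ Q f ≤ orliczNorm Φ Q g * orliczNorm Ψ Q h := by
    -- Strictly larger constants are admissible, so attainment of the infima is not needed; `h0` and
    -- `h1` exclude the product `0 * ∞`.
    refine ENNReal.le_mul_of_forall_lt (Or.inl h0) (Or.inl h1) fun a ha b hb => ?_
    obtain ⟨a', ha', haa⟩ := ENNReal.lt_iff_exists_nnreal_btwn.mp ha
    obtain ⟨b', hb', hbb⟩ := ENNReal.lt_iff_exists_nnreal_btwn.mp hb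
    refine le_trans ?_ (mul_le_mul' haa.le hbb.le)
    have ha0 : 0 < a' := ENNReal.coe_pos.mp (bot_le.trans_lt ha')
    have hb0 : 0 < b' := ENNReal.coe_pos.mp (bot_le.trans_lt hb')
    have hA := setLAverage_youngExt_le_of_lt hΦ ha'
    have hB := setLAverage_youngExt_le_of_lt hΨ hb'
    have key : orliczNorm Θ Q f ≤ ((2 * (a' * b') : ℝ≥0) : ℝ≥0∞) := by
      refine orliczNorm_le (by positivity) ?_
      calc ⨍⁻ x in Q, youngExt Θ (f x / ((2 * (a' * b') : ℝ≥0) : ℝ≥0∞)) ∂volume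
          ≤ ⨍⁻ x in Q, 2⁻¹ * (youngExt Φ (g x / a') + youngExt Ψ (h x / b')) ∂volume := by
            refine lintegral_mono fun x => ?_
            -- Where `g = ∞` the right side is already `∞`. In the application these are the zeros
            -- of the weight, where `f ≤ g * h` can fail.
            by_cases hx : g x = ∞
            · simp [hx, ENNReal.top_div_coe]
            refine le_trans (hΘ.monotone_youngExt ?_) (hΦ.youngExt_half_mul_le hΨ hΘ hinv _ _)
            refine le_trans (ENNReal.div_le_div_right (hfgh x hx) _) (le_of_eq ?_)
            push_cast
            rw [div_eq_mul_inv, div_eq_mul_inv, div_eq_mul_inv,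
              ENNReal.mul_inv (by simp) (by simp),
              ENNReal.mul_inv (Or.inr (by simp)) (Or.inl (by simp))]
            ring
        _ = 2⁻¹ * (⨍⁻ x in Q, youngExt Φ (g x / a') ∂volume
              + ⨍⁻ x in Q, youngExt Ψ (h x / b') ∂volume) := by
            have hm : Measurable fun x => youngExt Φ (g x / a') :=
              hΦ.measurable_youngExt.comp (hg.div_const _)
            rw [laverage, lintegral_const_mul' _ _ (by simp), lintegral_add_left hm]
            rfl
        _ ≤ 2⁻¹ * (1 + 1) := by gcongr
        _ = 1 := by rw [one_add_one_eq_two, ENNReal.inv_mul_cancel (by simp) (by simp)]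
    refine le_trans (mul_le_mul_right key _) (le_of_eq ?_)
    push_cast
    rw [← mul_assoc, ENNReal.inv_mul_cancel (by simp) (by simp), one_mul]
  calc orliczNorm Θ Q f = 2 * (2⁻¹ * orliczNorm Θ Q f) := by
        rw [← mul_assoc, ENNReal.mul_inv_cancel (by simp) (by simp), one_mul]
    _ ≤ _ := by gcongr

/-- If the norm were zero, `∫_Q Φ(k g) ≤ |Q|` for every `k`, and monotone convergence would give `∞
* |Q| ≤ |Q|`. -/
theorem orliczNorm_ne_zero (hΦ : IsYoungFunction Φ) (hg : Measurable g) (hpos : ∀ x, g x ≠ 0)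
    (hQ0 : volume Q ≠ 0) (hQ1 : volume Q ≠ ∞) : orliczNorm Φ Q g ≠ 0 := by
  intro h0
  have hk : ∀ k : ℕ, ∫⁻ x in Q, youngExt Φ (g x * k) ≤ volume Q := by
    intro k
    have hlt : orliczNorm Φ Q g < (((k + 1 : ℝ≥0)⁻¹ : ℝ≥0) : ℝ≥0∞) := by
      rw [h0]; exact ENNReal.coe_pos.mpr (by positivity)
    have h1 := setLAverage_youngExt_le_of_lt hΦ hlt
    rw [setLAverage_eq, ENNReal.div_le_iff hQ0 hQ1, one_mul] at h1
    refine le_trans (lintegral_mono fun x => hΦ.monotone_youngExt ?_) h1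
    rw [ENNReal.coe_inv (by positivity), div_eq_mul_inv, inv_inv]
    gcongr
    push_cast
    exact le_self_add
  have hsup : ∫⁻ x in Q, (⨆ k : ℕ, youngExt Φ (g x * k)) ≤ volume Q := by
    have hm : ∀ k : ℕ, Measurable fun x => youngExt Φ (g x * k) := fun k =>
      hΦ.measurable_youngExt.comp (hg.mul_const _)
    rw [lintegral_iSup hm (fun i j hij x => hΦ.monotone_youngExt (by gcongr))]
    exact iSup_le hk
  have htop : ∀ x, ⨆ k : ℕ, youngExt Φ (g x * k) = ∞ := by
    intro x
    refine ENNReal.eq_top_of_forall_nnreal_le fun r => ?_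
    obtain ⟨s, hs⟩ := hΦ.exists_lt r
    obtain ⟨k, hk⟩ := ENNReal.exists_nat_mul_gt (hpos x) (ENNReal.coe_ne_top (r := s))
    refine le_iSup_of_le k ?_
    refine le_trans (ENNReal.coe_le_coe.mpr hs.le) ?_
    rw [← youngExt_coe (Φ := Φ)]
    exact hΦ.monotone_youngExt (by rw [mul_comm]; exact hk.le)
  simp only [htop, lintegral_const, Measure.restrict_apply_univ, ENNReal.top_mul hQ0,
    top_le_iff] at hsup
  exact hQ1 hsup

end Orlicz

/-! ### Sparse selection and the Tauberian condition. -/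

/-- A finite family of sets has a subfamily whose members, taken by decreasing `r`, have a large
part outside the earlier members, and which covers a large part of every set of the family. -/
theorem exists_sparse_subfamily {X ι α : Type*} [MeasurableSpace X] [LinearOrder α]
    (μ : Measure X) (β : ι → Set X) (r : ι → α) {γ : ℝ≥0∞} (hγ : γ < 1) (s : Finset ι)
    (hmeas : ∀ j ∈ s, MeasurableSet (β j)) (h0 : ∀ j ∈ s, μ (β j) ≠ 0)
    (h1 : ∀ j ∈ s, μ (β j) ≠ ∞) :
    ∃ S ⊆ s, ∃ E : ι → Set X,
      (∀ j ∈ S, MeasurableSet (E j) ∧ E j ⊆ β j ∧ (1 - γ) * μ (β j) ≤ μ (E j)) ∧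
      (S : Set ι).PairwiseDisjoint E ∧
      ∀ j ∈ s, γ * μ (β j) < μ (β j ∩ ⋃ i ∈ {i ∈ S | r j ≤ r i}, β i) := by
  classical
  -- The set added last has the smallest `r`, so every earlier selected set qualifies to cover it.
  induction s using Finset.induction_on_min_value r with
  | empty => exact ⟨∅, by simp, fun _ => ∅, by simp, by simp, by simp⟩
  | insert a s ha hmin ih =>
    obtain ⟨S, hSs, E, hE, hdisj, hcov⟩ := ih (fun j hj => hmeas j (Finset.mem_insert_of_mem hj))
      (fun j hj => h0 j (Finset.mem_insert_of_mem hj))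
      (fun j hj => h1 j (Finset.mem_insert_of_mem hj))
    have haS : a ∉ S := fun h => ha (hSs h)
    have hma := hmeas a (Finset.mem_insert_self a s)
    -- Selection rule: `a` is kept exactly when the sets kept so far fill at most the fraction `γ`
    -- of `β a`.
    by_cases hsel : μ (β a ∩ ⋃ i ∈ S, β i) ≤ γ * μ (β a)
    · have hU : MeasurableSet (⋃ i ∈ S, β i) :=
        S.measurableSet_biUnion fun i hi => hmeas i (Finset.mem_insert_of_mem (hSs hi))
      have hne : ∀ j ∈ S, j ≠ a := fun j hj h => haS (h ▸ hj)
      refine ⟨insert a S, Finset.insert_subset_insert a hSs,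
        Function.update E a (β a \ ⋃ i ∈ S, β i), ?_, ?_, ?_⟩
      · intro j hj
        rcases Finset.mem_insert.mp hj with rfl | hj
        · simp only [Function.update_self]
          refine ⟨hma.diff hU, Set.sdiff_subset, ?_⟩
          have hfin := h1 j (Finset.mem_insert_self j s)
          rw [← Set.sdiff_inter_self_eq_sdiff, Set.inter_comm,
            measure_sdiff Set.inter_subset_left (hma.inter hU).nullMeasurableSet
              (measure_ne_top_of_subset Set.inter_subset_left hfin),
            ENNReal.sub_mul (fun _ _ => hfin), one_mul]
          exact tsub_le_tsub_left hsel _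
        · rw [Function.update_of_ne (hne j hj)]
          exact hE j hj
      · rw [Finset.coe_insert, Set.pairwiseDisjoint_insert_of_notMem (by simpa using haS)]
        refine ⟨?_, ?_⟩
        · intro i hi j hj hij
          simp only [Function.onFun, Function.update_of_ne (hne i hi),
            Function.update_of_ne (hne j hj)]
          exact hdisj hi hj hij
        · intro j hj
          rw [Function.update_self, Function.update_of_ne (hne j hj)]
          exact Set.disjoint_sdiff_left.mono_right
            ((hE j hj).2.1.trans (Set.subset_biUnion_of_mem (u := β) hj))
      · intro j hj
        rcases Finset.mem_insert.mp hj with rfl | hj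
        -- A kept set covers itself, and `γ < 1` makes the inequality strict.
        · have hsub : β j ⊆ ⋃ i ∈ {i ∈ insert j S | r j ≤ r i}, β i :=
            Set.subset_biUnion_of_mem (u := β) (by simp)
          rw [Set.inter_eq_left.mpr hsub]
          exact (ENNReal.mul_lt_mul_left (h0 j (Finset.mem_insert_self _ _))
            (h1 j (Finset.mem_insert_self _ _)) hγ).trans_eq (one_mul _)
        · refine (hcov j hj).trans_le (measure_mono ?_)
          refine Set.inter_subset_inter_right _ (Set.biUnion_subset_biUnion_left fun i hi => ?_)
          rw [Finset.mem_coe, Finset.mem_filter] at hi ⊢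
          exact ⟨Finset.mem_insert_of_mem hi.1, hi.2⟩
    · refine ⟨S, hSs.trans (Finset.subset_insert _ _), E, hE, hdisj, fun j hj => ?_⟩
      rcases Finset.mem_insert.mp hj with rfl | hj
      · rw [Finset.filter_true_of_mem fun i hi => hmin i (hSs hi)]
        exact not_le.mp hsel
      · exact hcov j hj

theorem Finset.measurable_sup_fun {X ι α : Type*} [MeasurableSpace X] [MeasurableSpace α]
    [SemilatticeSup α] [OrderBot α] [MeasurableSup₂ α] (s : Finset ι) {f : ι → X → α}
    (hf : ∀ i ∈ s, Measurable (f i)) : Measurable (s.sup f) := by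
  refine Finset.sup_induction measurable_const (fun g hg h hh => hg.sup hh) hf

/-- Under the Tauberian condition, the maximum of `r j` over the sets of a finite family containing
a point is controlled by a subfamily covering a large part of every set of the family. -/
theorem lintegral_sup_indicator_le_sum {n : ℕ} {ι : Type*}
    {𝓑 : Set (Set (EuclideanSpace ℝ (Fin n)))} {γ : ℝ≥0∞}
    {ν : Measure (EuclideanSpace ℝ (Fin n))} {K : ℝ≥0}
    (hK : ∀ E : Set (EuclideanSpace ℝ (Fin n)), MeasurableSet E →
      ν {x | γ < basisMaximal 𝓑 (E.indicator 1) x} ≤ K * ν E)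
    (β : ι → Set (EuclideanSpace ℝ (Fin n))) (r : ι → ℝ≥0) (s S : Finset ι) (hSs : S ⊆ s)
    (hβ : ∀ j ∈ s, β j ∈ 𝓑) (hmeas : ∀ j ∈ s, MeasurableSet (β j))
    (h0 : ∀ j ∈ s, volume (β j) ≠ 0) (h1 : ∀ j ∈ s, volume (β j) ≠ ∞)
    (hcov : ∀ j ∈ s, γ * volume (β j) < volume (β j ∩ ⋃ i ∈ {i ∈ S | r j ≤ r i}, β i)) :
    ∫⁻ x, s.sup (fun j => (β j).indicator (fun _ => (r j : ℝ≥0∞))) x ∂ν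
      ≤ K * ∑ j ∈ S, r j * ν (β j) := by
  set F : EuclideanSpace ℝ (Fin n) → ℝ≥0 :=
    fun x => s.sup fun j => (β j).indicator (fun _ => r j) x with hF
  set G : EuclideanSpace ℝ (Fin n) → ℝ≥0 :=
    fun x => ∑ j ∈ S, (β j).indicator (fun _ => r j) x with hG
  have hFm : Measurable F := by
    have : F = s.sup fun j => (β j).indicator (fun _ => r j) := by
      ext x; simp [hF, Finset.sup_apply]
    rw [this]
    exact Finset.measurable_sup_fun s fun j hj => measurable_const.indicator (hmeas j hj)
  have hGm : Measurable G :=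
    Finset.measurable_fun_sum S fun j hj => measurable_const.indicator (hmeas j (hSs hj))
  have hFe : ∀ x, s.sup (fun j => (β j).indicator (fun _ => (r j : ℝ≥0∞))) x
      = ENNReal.ofReal (F x) := by
    intro x
    rw [ENNReal.ofReal_coe_nnreal, hF, Finset.sup_apply]
    rw [Finset.apply_sup_eq_sup_comp_of_linearOrder (fun y : ℝ≥0 => (y : ℝ≥0∞)) ENNReal.coe_mono
      (by simp)]
    refine Finset.sup_congr rfl fun j _ => ?_
    by_cases hx : x ∈ β j <;> simp [hx]
  have hGe : ∫⁻ x, ENNReal.ofReal (G x) ∂ν = ∑ j ∈ S, r j * ν (β j) := by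
    calc ∫⁻ x, ENNReal.ofReal (G x) ∂ν
        = ∫⁻ x, ∑ j ∈ S, (β j).indicator (fun _ => (r j : ℝ≥0∞)) x ∂ν := by
          refine lintegral_congr fun x => ?_
          rw [ENNReal.ofReal_coe_nnreal, hG, ENNReal.ofNNReal_finsetSum]
          refine Finset.sum_congr rfl fun j _ => ?_
          by_cases hx : x ∈ β j <;> simp [hx]
      _ = _ := by
          rw [lintegral_finsetSum S fun j hj => measurable_const.indicator (hmeas j (hSs hj))]
          exact Finset.sum_congr rfl fun j hj => lintegral_indicator_const (hmeas j (hSs hj)) _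
  simp_rw [hFe]
  -- Layer-cake formula on both sides: it suffices to compare `{F > t}` with `{G > t}` for each `t >
  -- 0`.
  rw [← hGe, lintegral_eq_lintegral_meas_lt (f := fun x => (F x : ℝ)) ν (ae_of_all _ fun x => (F x).2)
      hFm.coe_nnreal_real.aemeasurable,
    lintegral_eq_lintegral_meas_lt (f := fun x => (G x : ℝ)) ν (ae_of_all _ fun x => (G x).2)
      hGm.coe_nnreal_real.aemeasurable, ← lintegral_const_mul' _ _ ENNReal.coe_ne_top]
  refine setLIntegral_mono' measurableSet_Ioi fun t ht => ?_
  set U := ⋃ i ∈ {i ∈ S | t < r i}, β i with hU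
  have hUm : MeasurableSet U :=
    Finset.measurableSet_biUnion _ fun i hi => hmeas i (hSs (Finset.mem_filter.mp hi).1)
  -- If `F x > t`, some `β j ∋ x` has `r j > t`. The sets covering its `γ`-part have coefficient at
  -- least `r j`, so they lie in `U`.
  have hsub : {x | t < (F x : ℝ)} ⊆ {x | γ < basisMaximal 𝓑 (U.indicator 1) x} := by
    intro x hx
    lift t to ℝ≥0 using (le_of_lt ht)
    obtain ⟨j, hj, hjt⟩ := (Finset.lt_sup_iff).mp (NNReal.coe_lt_coe.mp hx)
    have hxj : x ∈ β j := by
      by_contra hxj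
      simp [hxj] at hjt
    rw [Set.indicator_of_mem hxj] at hjt
    refine lt_of_lt_of_le ?_ (le_iSup₂ (f := fun (B : Set (EuclideanSpace ℝ (Fin n)))
      (_ : B ∈ 𝓑 ∧ x ∈ B) => ⨍⁻ y in B, U.indicator 1 y ∂volume) (β j) ⟨hβ j hj, hxj⟩)
    rw [setLAverage_eq, lintegral_indicator_one hUm, Measure.restrict_apply hUm,
      ENNReal.lt_div_iff_mul_lt (Or.inl (h0 j hj)) (Or.inl (h1 j hj)), Set.inter_comm]
    refine (hcov j hj).trans_le (measure_mono (Set.inter_subset_inter_right _ ?_))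
    refine Set.biUnion_subset_biUnion_left fun i hi => ?_
    simp only [Finset.mem_filter, NNReal.coe_lt_coe, Finset.mem_coe] at hi ⊢
    exact ⟨hi.1, hjt.trans_le hi.2⟩
  refine (measure_mono hsub).trans ((hK U hUm).trans ?_)
  gcongr
  intro x hx
  simp only [hU, Set.mem_iUnion, Finset.mem_filter] at hx
  obtain ⟨i, ⟨hi, hit⟩, hxi⟩ := hx
  refine lt_of_lt_of_le hit (NNReal.coe_le_coe.mpr ?_)
  have := Finset.single_le_sum (f := fun j => (β j).indicator (fun _ => r j) x)
    (fun _ _ => zero_le) hi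
  simpa [hxi] using this

theorem ENNReal.sum_rpow_le_rpow_sum {ι : Type*} (s : Finset ι) (f : ι → ℝ≥0∞) {a : ℝ}
    (ha : 1 ≤ a) : ∑ i ∈ s, f i ^ a ≤ (∑ i ∈ s, f i) ^ a := by
  classical
  induction s using Finset.induction_on with
  | empty => simp
  | insert i s hi ih =>
    rw [Finset.sum_insert hi, Finset.sum_insert hi]
    exact (add_le_add_right ih _).trans (ENNReal.add_rpow_le_rpow_add _ _ ha)

/-! ### From finite families to the full maximal function. -/

/-- An integral bound for the `q`-th power of the supremum of `c B` over the open sets `B ∋ x` of a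
collection follows from the corresponding bounds for finite subfamilies. -/
theorem lintegral_iSup_rpow_le_of_finset {X : Type*} [TopologicalSpace X]
    [SecondCountableTopology X] [MeasurableSpace X] [OpensMeasurableSpace X] (ν : Measure X)
    (𝓑 : Set (Set X)) (hopen : ∀ B ∈ 𝓑, IsOpen B) (c : Set X → ℝ≥0∞) {q : ℝ} (hq : 0 < q)
    {M : ℝ≥0∞}
    (h : ∀ s : Finset (Set X × ℝ≥0), (∀ j ∈ s, j.1 ∈ 𝓑 ∧ j.1.Nonempty ∧ j.2 < c j.1) →
      ∫⁻ x, s.sup (fun j => j.1.indicator (fun _ => ((j.2 ^ q : ℝ≥0) : ℝ≥0∞))) x ∂ν ≤ M) :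
    ∫⁻ x, (⨆ (B : Set X) (_ : B ∈ 𝓑 ∧ x ∈ B), c B) ^ q ∂ν ≤ M := by
  classical
  -- Lindelöf at each rational level: countably many open sets cover the same superlevel set of the
  -- supremum.
  have hT : ∀ r : ℚ, ∃ T ⊆ {B | B ∈ 𝓑 ∧ (r : ℝ).toNNReal < c B},
      T.Countable ∧ ⋃₀ T = ⋃₀ {B | B ∈ 𝓑 ∧ (r : ℝ).toNNReal < c B} := by
    intro r
    obtain ⟨T, hTc, hTs, hTU⟩ := TopologicalSpace.isOpen_sUnion_countable
      {B | B ∈ 𝓑 ∧ (r : ℝ).toNNReal < c B} fun B hB => hopen B hB.1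
    exact ⟨T, hTs, hTc, hTU⟩
  choose T hTs hTc hTU using hT
  set J : Set (Set X × ℝ≥0) :=
    ⋃ r : ℚ, (fun B => (B, (r : ℝ).toNNReal)) '' {B ∈ T r | B.Nonempty} with hJ
  have hJc : J.Countable := Set.countable_iUnion fun r => ((hTc r).mono fun B hB => hB.1).image _
  have hJm : ∀ j ∈ J, j.1 ∈ 𝓑 ∧ j.1.Nonempty ∧ j.2 < c j.1 := by
    intro j hj
    obtain ⟨r, B, hB, rfl⟩ := Set.mem_iUnion.mp hj
    exact ⟨(hTs r hB.1).1, hB.2, (hTs r hB.1).2⟩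
  have : Countable J := hJc.to_subtype
  set F : Finset J → X → ℝ≥0∞ := fun s =>
    (s.map (Function.Embedding.subtype _)).sup
      (fun j => j.1.indicator (fun _ => ((j.2 ^ q : ℝ≥0) : ℝ≥0∞))) with hF
  have hFmono : Monotone F := fun s t hst => Finset.sup_mono (Finset.map_subset_map.mpr hst)
  have hsJ : ∀ (s : Finset J), ∀ j ∈ s.map (Function.Embedding.subtype _), j ∈ J := by
    intro s j hj
    obtain ⟨i, -, rfl⟩ := Finset.mem_map.mp hj
    exact i.2
  have hFmeas : ∀ s, Measurable (F s) := fun s => Finset.measurable_sup_fun _ fun j hj =>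
    measurable_const.indicator (hopen _ (hJm j (hsJ s j hj)).1).measurableSet
  calc ∫⁻ x, (⨆ (B : Set X) (_ : B ∈ 𝓑 ∧ x ∈ B), c B) ^ q ∂ν
      ≤ ∫⁻ x, ⨆ s, F s x ∂ν := by
        refine lintegral_mono fun x => ENNReal.le_of_forall_nnreal_lt fun b hb => ?_
        have hb' : (b : ℝ≥0∞) ^ (1 / q) < ⨆ (B : Set X) (_ : B ∈ 𝓑 ∧ x ∈ B), c B := by
          rw [one_div]
          exact (ENNReal.rpow_inv_lt_iff hq).mpr hb
        obtain ⟨r, -, hbr, hr⟩ := ENNReal.lt_iff_exists_rat_btwn.mp hb'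
        obtain ⟨B, hB⟩ := lt_iSup_iff.mp hr
        obtain ⟨⟨hB𝓑, hxB⟩, hrB⟩ := lt_iSup_iff.mp hB
        have hx : x ∈ ⋃₀ T r := hTU r ▸ Set.mem_sUnion.mpr ⟨B, ⟨hB𝓑, hrB⟩, hxB⟩
        obtain ⟨B', hB', hxB'⟩ := hx
        have hmem : (B', (r : ℝ).toNNReal) ∈ J :=
          Set.mem_iUnion.mpr ⟨r, B', ⟨hB', ⟨x, hxB'⟩⟩, rfl⟩
        refine le_iSup_of_le {⟨_, hmem⟩} ?_
        simp only [hF, Finset.map_singleton, Finset.sup_singleton,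
          Function.Embedding.subtype_apply, Set.indicator_of_mem hxB']
        rw [ENNReal.coe_rpow_of_nonneg _ hq.le]
        rw [one_div] at hbr
        exact ((ENNReal.rpow_inv_lt_iff hq).mp hbr).le
    -- Monotone convergence over finite subsets of the index set `J`, which is countable.
    _ = ⨆ s, ∫⁻ x, F s x ∂ν := by
        refine lintegral_iSup_directed (fun s => (hFmeas s).aemeasurable) ?_
        exact hFmono.directed_le
    _ ≤ M := iSup_le fun s => h _ fun j hj => hJm j (hsJ s j hj)

/-- Integration of the maximum of a finite family against the Tauberian measure, compared with an
`L^p` norm of the maximal function with coefficients `d`. -/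
theorem lintegral_sup_indicator_rpow_le {n : ℕ} {𝓑 : Set (Set (EuclideanSpace ℝ (Fin n)))}
    (h𝓑 : IsMaximalBasis 𝓑) {γ : ℝ≥0∞} (hγ : γ < 1)
    {ν : Measure (EuclideanSpace ℝ (Fin n))} {K : ℝ≥0}
    (hK : ∀ E : Set (EuclideanSpace ℝ (Fin n)), MeasurableSet E →
      ν {x | γ < basisMaximal 𝓑 (E.indicator 1) x} ≤ K * ν E)
    {p q : ℝ} (hp : 0 < p) (hpq : p ≤ q) (c d : Set (EuclideanSpace ℝ (Fin n)) → ℝ≥0∞) (L : ℝ≥0∞)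
    (hcd : ∀ Q ∈ 𝓑, Q.Nonempty → c Q * ν Q ^ (1 / q) ≤ L * d Q * volume Q ^ (1 / p))
    (s : Finset (Set (EuclideanSpace ℝ (Fin n)) × ℝ≥0))
    (hs : ∀ j ∈ s, j.1 ∈ 𝓑 ∧ j.1.Nonempty ∧ j.2 < c j.1) :
    ∫⁻ x, s.sup (fun j => j.1.indicator (fun _ => ((j.2 ^ q : ℝ≥0) : ℝ≥0∞))) x ∂ν
      ≤ K * (L ^ q * ((1 - γ)⁻¹ *
        ∫⁻ x, (⨆ (Q : Set (EuclideanSpace ℝ (Fin n))) (_ : Q ∈ 𝓑 ∧ x ∈ Q), d Q) ^ p) ^ (q / p)) := by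
  have hq : 0 < q := hp.trans_le hpq
  have hγ0 : 1 - γ ≠ 0 := (tsub_pos_of_lt hγ).ne'
  have hγ1 : 1 - γ ≠ ∞ := ne_top_of_le_ne_top ENNReal.one_ne_top tsub_le_self
  have hmeas : ∀ j ∈ s, MeasurableSet j.1 := fun j hj => (h𝓑.isOpen _ (hs j hj).1).measurableSet
  have h0 : ∀ j ∈ s, volume j.1 ≠ 0 := fun j hj =>
    ((h𝓑.isOpen _ (hs j hj).1).measure_pos volume (hs j hj).2.1).ne'
  have h1 : ∀ j ∈ s, volume j.1 ≠ ∞ := fun j hj => (h𝓑.volume_lt_top _ (hs j hj).1).ne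
  obtain ⟨S, hSs, E, hE, hdisj, hcov⟩ := exists_sparse_subfamily volume Prod.fst
    (fun j => j.2 ^ q) hγ s hmeas h0 h1
  refine (lintegral_sup_indicator_le_sum hK Prod.fst (fun j => j.2 ^ q) s S hSs
    (fun j hj => (hs j hj).1) hmeas h0 h1 hcov).trans ?_
  gcongr
  set D : EuclideanSpace ℝ (Fin n) → ℝ≥0∞ :=
    fun x => ⨆ (Q : Set (EuclideanSpace ℝ (Fin n))) (_ : Q ∈ 𝓑 ∧ x ∈ Q), d Q with hD
  have hterm : ∀ j ∈ S, ((j.2 ^ q : ℝ≥0) : ℝ≥0∞) * ν j.1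
      ≤ L ^ q * (d j.1 ^ p * volume j.1) ^ (q / p) := by
    intro j hj
    obtain ⟨hj1, hj2, hj3⟩ := hs j (hSs hj)
    have h2 := ENNReal.rpow_le_rpow
      ((mul_le_mul_left hj3.le (ν j.1 ^ (1 / q))).trans (hcd j.1 hj1 hj2)) hq.le
    rw [ENNReal.mul_rpow_of_nonneg _ _ hq.le, ENNReal.mul_rpow_of_nonneg _ _ hq.le,
      ENNReal.mul_rpow_of_nonneg _ _ hq.le, ← ENNReal.rpow_mul, ← ENNReal.rpow_mul,
      one_div_mul_cancel hq.ne', ENNReal.rpow_one, ← ENNReal.coe_rpow_of_nonneg _ hq.le] at h2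
    refine h2.trans_eq ?_
    rw [ENNReal.mul_rpow_of_nonneg _ _ (by positivity), ← ENNReal.rpow_mul, mul_assoc,
      mul_div_cancel₀ _ hp.ne', one_div_mul_eq_div]
  -- `|j.1|` is at most `(1 - γ)⁻¹ |E j|`, and `D ≥ d j.1` on `E j`; the `E j` are disjoint.
  have hsum : ∑ j ∈ S, d j.1 ^ p * volume j.1 ≤ (1 - γ)⁻¹ * ∫⁻ x, D x ^ p := by
    calc ∑ j ∈ S, d j.1 ^ p * volume j.1
        ≤ ∑ j ∈ S, (1 - γ)⁻¹ * ∫⁻ x in E j, D x ^ p := by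
          refine Finset.sum_le_sum fun j hj => ?_
          obtain ⟨hEm, hEs, hEv⟩ := hE j hj
          calc d j.1 ^ p * volume j.1 = (1 - γ)⁻¹ * (d j.1 ^ p * ((1 - γ) * volume j.1)) := by
                rw [mul_left_comm (d j.1 ^ p), ← mul_assoc, ENNReal.inv_mul_cancel hγ0 hγ1, one_mul]
            _ ≤ (1 - γ)⁻¹ * (d j.1 ^ p * volume (E j)) := by gcongr
            _ ≤ _ := by
                gcongr
                rw [← setLIntegral_const]
                refine setLIntegral_mono' hEm fun x hx => ENNReal.rpow_le_rpow ?_ hp.le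
                exact le_iSup₂_of_le j.1 ⟨(hs j (hSs hj)).1, hEs hx⟩ le_rfl
      _ = (1 - γ)⁻¹ * ∫⁻ x in ⋃ j ∈ S, E j, D x ^ p := by
          rw [← Finset.mul_sum, lintegral_biUnion_finset hdisj fun j hj => (hE j hj).1]
      _ ≤ _ := by gcongr; exact Measure.restrict_le_self
  calc ∑ j ∈ S, ((j.2 ^ q : ℝ≥0) : ℝ≥0∞) * ν j.1
      ≤ ∑ j ∈ S, L ^ q * (d j.1 ^ p * volume j.1) ^ (q / p) := Finset.sum_le_sum hterm
    _ ≤ L ^ q * (∑ j ∈ S, d j.1 ^ p * volume j.1) ^ (q / p) := by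
        rw [← Finset.mul_sum]
        gcongr
        exact ENNReal.sum_rpow_le_rpow_sum S _ ((one_le_div hp).mpr hpq)
    _ ≤ _ := by gcongr

/-! ### The weighted estimate on one set and the conclusion. -/

theorem eLpNorm_mul_weight {n : ℕ} {w : EuclideanSpace ℝ (Fin n) → ℝ≥0} (hw : Measurable w)
    {p : ℝ} (hp : 0 < p) (f : EuclideanSpace ℝ (Fin n) → ℂ) :
    eLpNorm (fun x => f x * (w x : ℂ)) (ENNReal.ofReal p) volume
      = eLpNorm f (ENNReal.ofReal p) (powerWeightMeasure w p) := by
  have hp0 : ENNReal.ofReal p ≠ 0 := (ENNReal.ofReal_pos.mpr hp).ne'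
  rw [eLpNorm_eq_lintegral_rpow_enorm_toReal hp0 ENNReal.ofReal_ne_top,
    eLpNorm_eq_lintegral_rpow_enorm_toReal hp0 ENNReal.ofReal_ne_top, ENNReal.toReal_ofReal hp.le,
    powerWeightMeasure, lintegral_withDensity_eq_lintegral_mul_non_measurable _
      (hw.coe_nnreal_ennreal.pow_const p)
      (ae_of_all _ fun x => ENNReal.rpow_lt_top_of_nonneg hp.le ENNReal.coe_ne_top)]
  congr 1
  refine lintegral_congr fun x => ?_
  simp only [Pi.mul_apply]
  rw [enorm_mul, ENNReal.mul_rpow_of_nonneg _ _ hp.le, mul_comm]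
  congr 2
  simp [enorm_eq_nnnorm]

/-- The two-weight bump condition bounds `φ(|Q|) ∏ᵢ ‖fᵢ‖_{Bᵢ,Q} (∫_Q v^q)^{1/q}` on one set. -/
theorem mul_prod_orliczNorm_mul_le_of_bump {n m : ℕ} {p q : ℝ} {φ : ℝ → ℝ}
    (hφpos : ∀ t, 0 < t → 0 < φ t) {A B C : Fin m → ℝ≥0 → ℝ≥0}
    (hA : ∀ i, IsYoungFunction (A i)) (hB : ∀ i, IsYoungFunction (B i))
    (hC : ∀ i, IsYoungFunction (C i))
    (hABC : ∀ i, ∀ t : ℝ≥0, 0 < t → youngInv (A i) t * youngInv (C i) t ≤ youngInv (B i) t)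
    {w : Fin m → EuclideanSpace ℝ (Fin n) → ℝ≥0} {v : EuclideanSpace ℝ (Fin n) → ℝ≥0}
    (hw : ∀ i, Measurable (w i)) (hq : 0 < q)
    (f : Fin m → EuclideanSpace ℝ (Fin n) → ℂ)
    {Q : Set (EuclideanSpace ℝ (Fin n))} (hQm : MeasurableSet Q) (hQ0 : volume Q ≠ 0)
    (hQ1 : volume Q ≠ ∞) {H : ℝ≥0∞} (hH : H ≠ ∞)
    (hbump : ENNReal.ofReal (φ (volume.real Q)) * volume Q ^ (1 / q - 1 / p) *
        (⨍⁻ x in Q, (v x : ℝ≥0∞) ^ q ∂volume) ^ (1 / q) *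
        ∏ i, orliczNorm (A i) Q (fun x => (w i x : ℝ≥0∞)⁻¹) ≤ H) :
    ENNReal.ofReal (φ (volume.real Q)) * (∏ i, orliczNorm (B i) Q (fun y => ‖f i y‖ₑ)) *
        powerWeightMeasure v q Q ^ (1 / q)
      ≤ 2 ^ m * H * (∏ i, orliczNorm (C i) Q (fun y => ‖f i y * (w i y : ℂ)‖ₑ)) *
        volume Q ^ (1 / p) := by
  have hq' : 0 < 1 / q := by positivity
  -- If `v^q` has no mass on `Q`, the bump condition allows infinite norms of `(w i)⁻¹`, but the
  -- left side vanishes.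
  rcases eq_or_ne (powerWeightMeasure v q Q) 0 with hν | hν
  · rw [hν, ENNReal.zero_rpow_of_pos hq', mul_zero]
    exact zero_le
  set a := ⨍⁻ x in Q, (v x : ℝ≥0∞) ^ q ∂volume with ha
  have hνa : powerWeightMeasure v q Q = volume Q * a := by
    rw [powerWeightMeasure, withDensity_apply _ hQm, ha, setLAverage_eq,
      ENNReal.mul_div_cancel hQ0 hQ1]
  have ha0 : a ≠ 0 := by
    intro h
    rw [hνa, h, mul_zero] at hν
    exact hν rfl
  have hW0 : ∀ i, orliczNorm (A i) Q (fun x => (w i x : ℝ≥0∞)⁻¹) ≠ 0 := fun i =>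
    orliczNorm_ne_zero (hA i) (hw i).coe_nnreal_ennreal.inv
      (fun x => ENNReal.inv_ne_zero.mpr ENNReal.coe_ne_top) hQ0 hQ1
  have hφ0 : ENNReal.ofReal (φ (volume.real Q)) ≠ 0 :=
    (ENNReal.ofReal_pos.mpr (hφpos _ (ENNReal.toReal_pos hQ0 hQ1))).ne'
  have hcoef : ENNReal.ofReal (φ (volume.real Q)) * volume Q ^ (1 / q - 1 / p) * a ^ (1 / q)
      ≠ 0 := by
    refine mul_ne_zero (mul_ne_zero hφ0 ?_) ?_
    · exact (ENNReal.rpow_pos (pos_iff_ne_zero.mpr hQ0) hQ1).ne'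
    · exact fun h => ha0 ((ENNReal.rpow_eq_zero_iff_of_pos hq').mp h)
  -- All other factors being non-zero, one infinite norm would make the bump quantity infinite.
  have hW1 : ∀ i, orliczNorm (A i) Q (fun x => (w i x : ℝ≥0∞)⁻¹) ≠ ∞ := by
    intro i hi
    have hprod : ∏ i, orliczNorm (A i) Q (fun x => (w i x : ℝ≥0∞)⁻¹) = ∞ := by
      rw [← Finset.mul_prod_erase _ _ (Finset.mem_univ i), hi]
      exact ENNReal.top_mul (Finset.prod_ne_zero_iff.mpr fun j _ => hW0 j)
    rw [hprod, ENNReal.mul_top hcoef, top_le_iff] at hbump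
    exact hH hbump
  have hHol : ∀ i, orliczNorm (B i) Q (fun y => ‖f i y‖ₑ) ≤
      2 * (orliczNorm (A i) Q (fun x => (w i x : ℝ≥0∞)⁻¹) *
        orliczNorm (C i) Q (fun y => ‖f i y * (w i y : ℂ)‖ₑ)) := by
    intro i
    refine orliczNorm_le_two_mul (hA i) (hC i) (hB i) (hABC i) (hw i).coe_nnreal_ennreal.inv
      (fun x hx => ?_) (hW0 i) (hW1 i)
    have hwx : (w i x : ℝ≥0∞) ≠ 0 := fun h => hx (by simp [h])
    have he : ‖(w i x : ℂ)‖ₑ = w i x := by simp [enorm_eq_nnnorm]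
    rw [enorm_mul, he, mul_comm ‖f i x‖ₑ, ← mul_assoc,
      ENNReal.inv_mul_cancel hwx ENNReal.coe_ne_top, one_mul]
  have hvol : volume Q ^ (1 / q) = volume Q ^ (1 / q - 1 / p) * volume Q ^ (1 / p) := by
    rw [← ENNReal.rpow_add _ _ hQ0 hQ1, sub_add_cancel]
  calc _ ≤ ENNReal.ofReal (φ (volume.real Q)) *
          (∏ i, 2 * (orliczNorm (A i) Q (fun x => (w i x : ℝ≥0∞)⁻¹) *
            orliczNorm (C i) Q (fun y => ‖f i y * (w i y : ℂ)‖ₑ))) *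
          powerWeightMeasure v q Q ^ (1 / q) := by
        gcongr with i
        exact hHol i
    _ = 2 ^ m * (ENNReal.ofReal (φ (volume.real Q)) * volume Q ^ (1 / q - 1 / p) * a ^ (1 / q) *
          ∏ i, orliczNorm (A i) Q (fun x => (w i x : ℝ≥0∞)⁻¹)) *
          (∏ i, orliczNorm (C i) Q (fun y => ‖f i y * (w i y : ℂ)‖ₑ)) * volume Q ^ (1 / p) := by
        rw [Finset.prod_mul_distrib, Finset.prod_mul_distrib, Finset.prod_const,
          Finset.card_univ, Fintype.card_fin, hνa, ENNReal.mul_rpow_of_nonneg _ _ hq'.le, hvol]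
        ring
    _ ≤ _ := by gcongr

theorem theorem2p6 {n m : ℕ}
    (p q : ℝ) (pv : Fin m → ℝ)
    (hp : 0 < p) (hpq : p ≤ q) (hpv : ∀ i, 1 < pv i) (hpsum : 1 / p = ∑ i, 1 / pv i)
    (𝓑 : Set (Set (EuclideanSpace ℝ (Fin n)))) (h𝓑 : IsMaximalBasis 𝓑)
    (φ : ℝ → ℝ) (hφpos : ∀ t, 0 < t → 0 < φ t) (hφmono : EssentiallyNondecreasing φ)
    (hφlim : Tendsto (fun t => φ t / t) atTop (𝓝 0))
    (A B C : Fin m → ℝ≥0 → ℝ≥0)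
    (hA : ∀ i, IsYoungFunction (A i)) (hB : ∀ i, IsYoungFunction (B i))
    (hC : ∀ i, IsYoungFunction (C i))
    (hABC : ∀ i, ∀ t : ℝ≥0, 0 < t → youngInv (A i) t * youngInv (C i) t ≤ youngInv (B i) t)
    (hbound : BoundedOperator (orliczMaximal 𝓑 (fun _ => 1) C) pv (fun _ => volume) p volume)
    (w : Fin m → EuclideanSpace ℝ (Fin n) → ℝ≥0) (v : EuclideanSpace ℝ (Fin n) → ℝ≥0)
    (hw : ∀ i, Measurable (w i)) (hv : Measurable v)
    (γ : ℝ) (hγ0 : 0 < γ) (hγ1 : γ < 1)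
    (hTaub : TauberianCondition 𝓑 γ (powerWeightMeasure v q))
    (hbump : ⨆ Q ∈ 𝓑, ENNReal.ofReal (φ (volume.real Q)) * volume Q ^ (1 / q - 1 / p) *
        (⨍⁻ x in Q, (v x : ℝ≥0∞) ^ q ∂volume) ^ (1 / q) *
        ∏ i, orliczNorm (A i) Q (fun x => (w i x : ℝ≥0∞)⁻¹) < ∞) :
    BoundedOperator (orliczMaximal 𝓑 φ B) pv (fun i => powerWeightMeasure (w i) (pv i))
      q (powerWeightMeasure v q) := by
  obtain ⟨K, hK⟩ := hTaub
  obtain ⟨K₂, hK₂⟩ := hbound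
  have hq : 0 < q := hp.trans_le hpq
  have hγ : ENNReal.ofReal γ < 1 := ENNReal.ofReal_lt_one.mpr hγ1
  set H := ⨆ Q ∈ 𝓑, ENNReal.ofReal (φ (volume.real Q)) * volume Q ^ (1 / q - 1 / p) *
    (⨍⁻ x in Q, (v x : ℝ≥0∞) ^ q ∂volume) ^ (1 / q) *
    ∏ i, orliczNorm (A i) Q (fun x => (w i x : ℝ≥0∞)⁻¹) with hH
  have hpq' : 0 ≤ q / p := by positivity
  -- Tauberian constant `K`, one-set constant `2 ^ m * H` and sparseness constant `(1 - γ)⁻¹`, with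
  -- the exponents they acquire in the bound for the `q`-th power.
  set c₀ : ℝ≥0∞ := (K * ((2 ^ m * H) ^ q * (1 - ENNReal.ofReal γ)⁻¹ ^ (q / p))) ^ (1 / q) with hc₀
  have hc₀top : c₀ * K₂ ≠ ∞ := by
    have h1 : (1 - ENNReal.ofReal γ)⁻¹ ≠ ∞ := ENNReal.inv_ne_top.mpr (tsub_pos_of_lt hγ).ne'
    have h2 : 2 ^ m * H ≠ ∞ := ENNReal.mul_ne_top (by finiteness) hbump.ne
    finiteness
  refine ⟨(c₀ * K₂).toNNReal, fun f hf hfL => ?_⟩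
  set g : Fin m → EuclideanSpace ℝ (Fin n) → ℂ := fun i x => f i x * (w i x : ℂ) with hg
  have hgm : ∀ i, AEStronglyMeasurable (g i) volume := fun i =>
    (hf i).mul (Complex.measurable_ofReal.comp
      (hw i).coe_nnreal_real).aestronglyMeasurable
  have hgN : ∀ i, eLpNorm (g i) (ENNReal.ofReal (pv i)) volume
      = eLpNorm (f i) (ENNReal.ofReal (pv i)) (powerWeightMeasure (w i) (pv i)) := fun i =>
    eLpNorm_mul_weight (hw i) (one_pos.trans (hpv i)) (f i)
  have hmain := hK₂ g hgm fun i => ⟨hgm i, (hgN i).trans_lt (hfL i).2⟩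
  simp_rw [hgN] at hmain
  set d : Set (EuclideanSpace ℝ (Fin n)) → ℝ≥0∞ :=
    fun Q => ∏ i, orliczNorm (C i) Q (fun y => ‖g i y‖ₑ) with hd
  have hCmax : orliczMaximal 𝓑 (fun _ => 1) C g
      = fun x => ⨆ (Q : Set (EuclideanSpace ℝ (Fin n))) (_ : Q ∈ 𝓑 ∧ x ∈ Q), d Q := by
    ext x
    simp [orliczMaximal, hd]
  have hint : ∫⁻ x, orliczMaximal 𝓑 φ B f x ^ q ∂(powerWeightMeasure v q)
      ≤ K * ((2 ^ m * H) ^ q * ((1 - ENNReal.ofReal γ)⁻¹ *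
        ∫⁻ x, orliczMaximal 𝓑 (fun _ => 1) C g x ^ p) ^ (q / p)) := by
    rw [hCmax]
    refine lintegral_iSup_rpow_le_of_finset _ 𝓑 h𝓑.isOpen _ hq fun s hs => ?_
    refine lintegral_sup_indicator_rpow_le h𝓑 hγ hK hp hpq (fun Q =>
      ENNReal.ofReal (φ (volume.real Q)) * ∏ i, orliczNorm (B i) Q (fun y => ‖f i y‖ₑ)) d _ (fun Q hQ hQne => ?_) s hs
    exact mul_prod_orliczNorm_mul_le_of_bump hφpos hA hB hC hABC hw hq f
      (h𝓑.isOpen Q hQ).measurableSet ((h𝓑.isOpen Q hQ).measure_pos volume hQne).ne'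
      (h𝓑.volume_lt_top Q hQ).ne hbump.ne (le_iSup₂_of_le Q hQ le_rfl)
  have hfinal : eLpNorm (orliczMaximal 𝓑 φ B f) (ENNReal.ofReal q) (powerWeightMeasure v q)
      ≤ c₀ * eLpNorm (orliczMaximal 𝓑 (fun _ => 1) C g) (ENNReal.ofReal p) volume := by
    rw [eLpNorm_eq_lintegral_rpow_enorm_toReal (ENNReal.ofReal_pos.mpr hq).ne'
        ENNReal.ofReal_ne_top,
      eLpNorm_eq_lintegral_rpow_enorm_toReal (ENNReal.ofReal_pos.mpr hp).ne'
        ENNReal.ofReal_ne_top, ENNReal.toReal_ofReal hq.le, ENNReal.toReal_ofReal hp.le]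
    simp only [enorm_eq_self]
    refine (ENNReal.rpow_le_rpow hint (by positivity : 0 ≤ 1 / q)).trans_eq ?_
    rw [ENNReal.mul_rpow_of_nonneg _ _ hpq', ← mul_assoc ((2 ^ m * H) ^ q), ← mul_assoc (K : ℝ≥0∞),
      ENNReal.mul_rpow_of_nonneg _ _ (by positivity : 0 ≤ 1 / q), ← ENNReal.rpow_mul]
    congr 2
    field_simp
  rw [ENNReal.coe_toNNReal hc₀top, mul_assoc]
  exact hfinal.trans (by gcongr)
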